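/- Let $Q_0\subset\mathbb R^n$ be a cube (all cubes are nondegenerate, with sides parallel to the coordinate axes), let $l(Q)$ be the side length and $|Q|$ the Lebesgue measure of a cube $Q$, and put $f_Q=\frac1{|Q|}\int_Q f$. For $1<p<\infty$ let $S_p(Q_0)$ be the class of $f\in L^1(Q_0)$ for which there are a constant $c>0$ and a function $g\in L^p(Q_0)$ with $$\frac1{|Q|}\int_Q|f-f_Q|\,dx\le c\,l(Q)\Big(\frac1{|Q|}\int_Q|g|^p\,dx\Big)^{1/p}\qquad\text{for all subcubes }Q\subset Q_0.\tag{1}$$ For $1<r\le\infty$ let $\|f\|_{GaRo_r(Q_0)}$ be the infimum of the constants $C$ such that $$\sum_i\frac1{|Q_i|}\int_{Q_i}\int_{Q_i}|f(x)-f(y)|\,dx\,dy\le C\Big(\sum_i|Q_i|\Big)^{1-1/r}$$ for every countable family $\{Q_i\}$ of subcubes of $Q_0$ with pairwise disjoint interiors (with value $\infty$ if there is no such $C$), and let $GaRo_r(Q_0)$ be the set of $f\in L^1(Q_0)$ for which it is finite. Let $BMO(Q_0)$ be the set of $f\in L^1(Q_0)$ with $\sup_{Q\subset Q_0}\frac1{|Q|}\int_Q|f-f_Q|<\infty$.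 For $1<r<\infty$ let $L(r,\infty)(Q_0)$ be the set of measurable $f$ on $Q_0$ with $\|f\|^*_{L(r,\infty)}=\sup_{t>0}t^{1/r}f^*(t)<\infty$, where $f^*(t)=\inf\{s\ge0:|\{x\in Q_0:|f(x)|>s\}|\le t\}$. (i) Let $1<p<n$ and $\frac1{p^*}=\frac1p-\frac1n$. If $f\in S_p(Q_0)$, then $f\in L(p^*,\infty)(Q_0)$. Moreover, there are constants $c_n$, depending only on $n$, and $K(n,p)$, depending only on $n$ and $p$, such that whenever $f\in L^1(Q_0)$, $c>0$ and $g\in L^p(Q_0)$ satisfy (1), $$\|f\|_{GaRo_{p^*}(Q_0)}\le 2c\,c_n\|g\|_{L^p(Q_0)},\qquad \|f-f_{Q_0}\|^*_{L(p^*,\infty)}\le K(n,p)\,c\,\|g\|_{L^p(Q_0)}.$$ (ii) Let $p=n>1$. If $f\in S_n(Q_0)$, then $f\in GaRo_\infty(Q_0)$, and $GaRo_\infty(Q_0)=BMO(Q_0)$. -/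

import Mathlib

open MeasureTheory
open scoped ENNReal NNReal

noncomputable section

/-- A nondegenerate cube in `ℝⁿ` with sides parallel to the coordinate axes. The space `ℝⁿ` is
`Fin n → ℝ`; only its order, topology and Lebesgue measure are used, never its norm. -/
structure Cube (n : ℕ) where
  corner : Fin n → ℝ
  side : ℝ
  side_pos : 0 < side

namespace Cube

/-- The (closed) cube as a set of points. -/
def toSet {n : ℕ} (Q : Cube n) : Set (Fin n → ℝ) :=
  Set.Icc Q.corner (fun i => Q.corner i + Q.side)

/-- The mean value `f_Q` of `f` over `Q`. -/
def mean {n : ℕ} (Q : Cube n) (f : (Fin n → ℝ) → ℝ) : ℝ :=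
  ⨍ x in Q.toSet, f x

/-- The mean oscillation `|Q|⁻¹ ∫_Q |f - f_Q|`. -/
def meanOsc {n : ℕ} (Q : Cube n) (f : (Fin n → ℝ) → ℝ) : ℝ :=
  ⨍ x in Q.toSet, |f x - Q.mean f|

end Cube

/-- `P(Q₀)`: countable (finite or infinite) families of subcubes of `Q₀` with pairwise disjoint
interiors. Since cubes are nondegenerate, members of such a family are distinct, so a family is
a set of cubes. -/
def cubePackings {n : ℕ} (Q₀ : Cube n) : Set (Set (Cube n)) :=
  {F | F.Countable ∧ (∀ Q ∈ F, Q.toSet ⊆ Q₀.toSet) ∧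
    F.Pairwise fun Q R => Disjoint (interior Q.toSet) (interior R.toSet)}

/-- The Garsia–Rodemich condition with exponent `p` (possibly `∞`) and constant `C`: for every
family in `P(Q₀)`,
`∑ᵢ |Qᵢ|⁻¹ ∫_{Qᵢ} ∫_{Qᵢ} |f(x) - f(y)| dx dy ≤ C (∑ᵢ |Qᵢ|) ^ (1 - 1/p)`. -/
def GaRoBound {n : ℕ} (Q₀ : Cube n) (p : ℝ≥0∞) (f : (Fin n → ℝ) → ℝ) (C : ℝ≥0∞) : Prop :=
  ∀ F ∈ cubePackings Q₀,
    ∑' Q : F, (volume Q.1.toSet)⁻¹ * ∫⁻ x in Q.1.toSet, ∫⁻ y in Q.1.toSet, ‖f x - f y‖ₑ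
      ≤ C * (∑' Q : F, volume Q.1.toSet) ^ (1 - (p⁻¹).toReal)

/-- The space `GaRo_p(Q₀)`. -/
def GaRo {n : ℕ} (Q₀ : Cube n) (p : ℝ≥0∞) : Set ((Fin n → ℝ) → ℝ) :=
  {f | IntegrableOn f Q₀.toSet ∧ ∃ C : ℝ≥0, 0 < C ∧ GaRoBound Q₀ p f C}

/-- The seminorm of `GaRo_p(Q₀)`, with value `∞` when no finite constant works. -/
def gaRoNorm {n : ℕ} (Q₀ : Cube n) (p : ℝ≥0∞) (f : (Fin n → ℝ) → ℝ) : ℝ≥0∞ :=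
  sInf {C : ℝ≥0∞ | GaRoBound Q₀ p f C}

/-- The space `BMO(Q₀)` of functions of bounded mean oscillation. -/
def BMO {n : ℕ} (Q₀ : Cube n) : Set ((Fin n → ℝ) → ℝ) :=
  {f | IntegrableOn f Q₀.toSet ∧ ∃ C : ℝ, ∀ Q : Cube n, Q.toSet ⊆ Q₀.toSet → Q.meanOsc f ≤ C}

/-- The non-increasing rearrangement `f*(t) = inf {s ≥ 0 : μ {|f| > s} ≤ t}`. -/
def rearrangement {α : Type*} [MeasurableSpace α] (μ : Measure α) (f : α → ℝ) (t : ℝ≥0) : ℝ≥0∞ :=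
  sInf {s : ℝ≥0∞ | μ {x | s < ‖f x‖ₑ} ≤ t}

/-- The weak-type quasinorm `‖f‖*_{L(q,∞)(Q₀)} = sup_{t > 0} t^{1/q} f*(t)`, where the
rearrangement is that of the restriction of `f` to `Q₀`. -/
def weakNorm {n : ℕ} (Q₀ : Cube n) (q : ℝ) (f : (Fin n → ℝ) → ℝ) : ℝ≥0∞ :=
  ⨆ (t : ℝ≥0) (_ : 0 < t), (t : ℝ≥0∞) ^ (1 / q) * rearrangement (volume.restrict Q₀.toSet) f t

/-- The Marcinkiewicz space `L(q,∞)(Q₀)`. -/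
def WeakL {n : ℕ} (Q₀ : Cube n) (q : ℝ) : Set ((Fin n → ℝ) → ℝ) :=
  {f | AEStronglyMeasurable f (volume.restrict Q₀.toSet) ∧ weakNorm Q₀ q f < ∞}

/-- `f ∈ L¹(Q₀)` satisfies the `(1,p)` Poincaré inequality on all subcubes of `Q₀` with upper
gradient `g ∈ L^p(Q₀)` and constant `c > 0`. -/
structure PoincareWith {n : ℕ} (Q₀ : Cube n) (p : ℝ) (f : (Fin n → ℝ) → ℝ) (c : ℝ)
    (g : (Fin n → ℝ) → ℝ) : Prop where
  integrable : IntegrableOn f Q₀.toSet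
  const_pos : 0 < c
  memLp : MemLp g (ENNReal.ofReal p) (volume.restrict Q₀.toSet)
  bound : ∀ Q : Cube n, Q.toSet ⊆ Q₀.toSet →
    Q.meanOsc f ≤ c * Q.side * (⨍ x in Q.toSet, |g x| ^ p) ^ (1 / p)

/-- The class `S_p(Q₀)`. -/
def PoincareClass {n : ℕ} (Q₀ : Cube n) (p : ℝ) : Set ((Fin n → ℝ) → ℝ) :=
  {f | ∃ (c : ℝ) (g : (Fin n → ℝ) → ℝ), PoincareWith Q₀ p f c g}

end

/-! Garsia–Rodemich bounds. On a cube the double oscillation `|Q|⁻¹∫∫|f(x) - f(y)|` lies between one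
and two times `∫_Q |f - f_Q|`. Writing the side as `|Q|^(1/n)`, the Poincaré inequality bounds it by
`2c |Q|^(1 + 1/n - 1/p) (∫_Q |g|^p)^(1/p)`. Hölder over a packing sums these bounds
(`PoincareWith.gaRoBound`), with no dimensional loss, so `cn = 1` works. For `p = n` the same bound
is the exponent-`∞` condition; there the condition is additive over cubes, hence equivalent to its
single-cube version, which is BMO.

Weak type. The estimate is proved directly, by a Hedberg-type argument, and not through the
Garsia–Rodemich norm. At a.e. `x`, `f x - f_{Q₀}` telescopes along cubes of side `2^(-k) l(Q₀)`
shrinking to `x`, so it is controlled by the sum of their mean oscillations. Let `‖g‖_p ≤ B` and let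
all averages of `|g|^p` over subcubes containing `x` be at most `s`. The oscillation at side `l` is
then at most `c l s^(1/p)` and at most `c B l^(1 - n/p)`. The first bound sums over small cubes and
the second, since `p < n`, over large ones, giving `|f x - f_{Q₀}| ≲ c B^(p/n) s^(1/q)`
(`PoincareWith.abs_sub_mean_le`). By Vitali covering the exceptional set has measure at most `5^n
B^p / s`; setting this equal to `t` yields the rearrangement bound. -/

noncomputable section

open Filter Topology Metric

/-! ### Cubes as sup-norm balls; comparison of the oscillations. -/

namespace Cube

variable {n : ℕ}

/-- The center of a cube. -/
def center (Q : Cube n) : Fin n → ℝ := fun i => Q.corner i + Q.side / 2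

lemma toSet_eq_closedBall (Q : Cube n) : Q.toSet = closedBall Q.center (Q.side / 2) := by
  have h := Q.side_pos
  rw [closedBall_pi _ (by positivity), Cube.toSet, ← Set.pi_univ_Icc]
  congr 1
  ext i : 1
  rw [Real.closedBall_eq_Icc, center]
  congr 1 <;> ring

lemma measurableSet_toSet (Q : Cube n) : MeasurableSet Q.toSet := measurableSet_Icc

lemma volume_toSet (Q : Cube n) : volume Q.toSet = ENNReal.ofReal Q.side ^ n := by
  simp [Cube.toSet, Real.volume_Icc_pi]

lemma volume_pos (Q : Cube n) : 0 < volume Q.toSet := by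
  rw [volume_toSet]
  exact ENNReal.pow_pos (by simpa using Q.side_pos) n

lemma volume_ne_zero (Q : Cube n) : volume Q.toSet ≠ 0 := Q.volume_pos.ne'

lemma volume_ne_top (Q : Cube n) : volume Q.toSet ≠ ∞ := by
  rw [volume_toSet]
  exact ENNReal.pow_ne_top ENNReal.ofReal_ne_top

lemma volume_real (Q : Cube n) : volume.real Q.toSet = Q.side ^ n := by
  rw [measureReal_def, volume_toSet, ENNReal.toReal_pow, ENNReal.toReal_ofReal Q.side_pos.le]

lemma volume_closedBall_center (Q : Cube n) {τ : ℝ} (hτ : 0 ≤ τ) :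
    volume (closedBall Q.center (τ * (Q.side / 2))) = ENNReal.ofReal τ ^ n * volume Q.toSet := by
  have h := Q.side_pos
  rw [Real.volume_pi_closedBall _ (by positivity), volume_toSet, ← mul_pow,
    ← ENNReal.ofReal_mul hτ, Fintype.card_fin, ← ENNReal.ofReal_pow (by positivity)]
  congr 2
  ring

lemma interior_ae_eq (Q : Cube n) : interior Q.toSet =ᵐ[volume] Q.toSet :=
  interior_ae_eq_of_null_frontier ((convex_Icc _ _).addHaar_frontier _)

lemma interior_nonempty (Q : Cube n) : (interior Q.toSet).Nonempty := by
  refine nonempty_of_measure_ne_zero (μ := volume) ?_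
  rw [measure_congr Q.interior_ae_eq]
  exact Q.volume_ne_zero

lemma setLIntegral_enorm_sub_mean (Q : Cube n) {f : (Fin n → ℝ) → ℝ}
    (hf : IntegrableOn f Q.toSet) :
    ∫⁻ x in Q.toSet, ‖f x - Q.mean f‖ₑ = volume Q.toSet * ENNReal.ofReal (Q.meanOsc f) := by
  have hc : IntegrableOn (fun x => |f x - Q.mean f|) Q.toSet :=
    (hf.sub (integrableOn_const Q.volume_ne_top)).abs
  rw [meanOsc, ofReal_setAverage hc (Eventually.of_forall fun x => abs_nonneg _),
    ENNReal.mul_div_cancel Q.volume_ne_zero Q.volume_ne_top]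
  simp only [Real.enorm_eq_ofReal_abs]

/-- The mean double oscillation `|Q|⁻¹ ∫_Q ∫_Q |f(x) - f(y)| dx dy`. -/
def doubleOsc (Q : Cube n) (f : (Fin n → ℝ) → ℝ) : ℝ≥0∞ :=
  (volume Q.toSet)⁻¹ * ∫⁻ x in Q.toSet, ∫⁻ y in Q.toSet, ‖f x - f y‖ₑ

lemma doubleOsc_le (Q : Cube n) {f : (Fin n → ℝ) → ℝ} (hf : IntegrableOn f Q.toSet) :
    Q.doubleOsc f ≤ 2 * (volume Q.toSet * ENNReal.ofReal (Q.meanOsc f)) := by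
  have hA := Q.setLIntegral_enorm_sub_mean hf
  rw [← hA]
  set A := ∫⁻ x in Q.toSet, ‖f x - Q.mean f‖ₑ
  set V := volume Q.toSet with hV
  have key : ∫⁻ x in Q.toSet, ∫⁻ y in Q.toSet, ‖f x - f y‖ₑ ≤ V * (2 * A) := by
    calc ∫⁻ x in Q.toSet, ∫⁻ y in Q.toSet, ‖f x - f y‖ₑ
        ≤ ∫⁻ x in Q.toSet, (‖f x - Q.mean f‖ₑ * V + A) := by
          refine lintegral_mono fun x => ?_
          calc ∫⁻ y in Q.toSet, ‖f x - f y‖ₑ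
              ≤ ∫⁻ y in Q.toSet, (‖f x - Q.mean f‖ₑ + ‖f y - Q.mean f‖ₑ) := by
                refine lintegral_mono fun y => ?_
                have : f x - f y = (f x - Q.mean f) - (f y - Q.mean f) := by ring
                rw [this]
                exact enorm_sub_le
            _ = _ := by
                rw [lintegral_add_left measurable_const, setLIntegral_const]
      _ = V * (2 * A) := by
          rw [lintegral_add_right _ measurable_const, setLIntegral_const,
            lintegral_mul_const' _ _ Q.volume_ne_top]
          ring
  calc Q.doubleOsc f ≤ V⁻¹ * (V * (2 * A)) := by unfold doubleOsc; gcongr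
    _ = 2 * A := by
      rw [← mul_assoc, ENNReal.inv_mul_cancel Q.volume_ne_zero Q.volume_ne_top, one_mul]

lemma volume_mul_meanOsc_le (Q : Cube n) {f : (Fin n → ℝ) → ℝ} (hf : IntegrableOn f Q.toSet) :
    volume Q.toSet * ENNReal.ofReal (Q.meanOsc f) ≤ Q.doubleOsc f := by
  rw [← Q.setLIntegral_enorm_sub_mean hf, doubleOsc, ← lintegral_const_mul' _ _
    (ENNReal.inv_ne_top.2 Q.volume_ne_zero)]
  refine lintegral_mono fun x => ?_
  -- The deviation from the mean is the average over `y` of `f x - f y`.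
  have hx : f x - Q.mean f = (volume.real Q.toSet)⁻¹ • ∫ y in Q.toSet, (f x - f y) := by
    have hc : IntegrableOn (fun _ => f x) Q.toSet := integrableOn_const Q.volume_ne_top
    rw [integral_sub hc hf, smul_sub, setIntegral_const, mean,
      setAverage_eq, inv_smul_smul₀]
    exact (ENNReal.toReal_pos Q.volume_ne_zero Q.volume_ne_top).ne'
  rw [hx, enorm_smul]
  gcongr
  · rw [Real.enorm_eq_ofReal (by positivity), measureReal_def,
      ENNReal.ofReal_inv_of_pos (ENNReal.toReal_pos Q.volume_ne_zero Q.volume_ne_top),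
      ENNReal.ofReal_toReal Q.volume_ne_top]
  · exact enorm_integral_le_lintegral_enorm _

end Cube

/-- For `r = ∞` the right-hand side is linear in the volumes, so testing one-cube families is
enough. -/
lemma GaRo_top_eq_BMO {n : ℕ} (Q₀ : Cube n) : GaRo Q₀ ∞ = BMO Q₀ := by
  ext f
  constructor
  · rintro ⟨hf, C, -, hC⟩
    refine ⟨hf, C, fun Q hQ => ?_⟩
    have h := hC {Q} ⟨Set.countable_singleton _, by simpa using hQ, Set.pairwise_singleton _ _⟩
    rw [tsum_singleton Q fun Q : Cube n => (volume Q.toSet)⁻¹ *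
      ∫⁻ x in Q.toSet, ∫⁻ y in Q.toSet, ‖f x - f y‖ₑ,
      tsum_singleton Q fun Q : Cube n => volume Q.toSet] at h
    have h2 := (Q.volume_mul_meanOsc_le (hf.mono_set hQ)).trans h
    simp only [ENNReal.inv_top, ENNReal.toReal_zero, sub_zero, ENNReal.rpow_one] at h2
    rw [mul_comm, ENNReal.mul_le_mul_iff_left Q.volume_ne_zero Q.volume_ne_top] at h2
    exact Real.toNNReal_le_iff_le_coe.1 (ENNReal.coe_le_coe.1 h2)
  · rintro ⟨hf, C, hC⟩
    -- The `2` comes from `doubleOsc_le`; the `+ 1` only makes the constant positive.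
    refine ⟨hf, 2 * C.toNNReal + 1, by positivity, fun F hF => ?_⟩
    simp only [ENNReal.inv_top, ENNReal.toReal_zero, sub_zero, ENNReal.rpow_one]
    rw [← ENNReal.tsum_mul_left]
    refine ENNReal.tsum_le_tsum fun Q => ?_
    refine (Q.1.doubleOsc_le (hf.mono_set (hF.2.1 _ Q.2))).trans ?_
    rw [mul_comm (volume _), ← mul_assoc]
    gcongr
    have := ENNReal.ofReal_le_ofReal (hC Q (hF.2.1 _ Q.2))
    push_cast
    exact (mul_le_mul_right this 2).trans le_self_add

/-! ### Summation over packings and the Garsia–Rodemich bounds. -/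

/-- Split the exponent as `a + 1/p'`: bound each `V i ^ a` by the total to the power `a`, then apply
Hölder to the rest. -/
lemma ENNReal.tsum_rpow_mul_rpow_le {ι : Type*} (V A : ι → ℝ≥0∞) {p : ℝ} (hp : 1 < p) {a : ℝ}
    (ha : 0 ≤ a) :
    ∑' i, V i ^ (1 + a - 1 / p) * A i ^ (1 / p)
      ≤ (∑' i, V i) ^ (1 + a - 1 / p) * (∑' i, A i) ^ (1 / p) := by
  have hp0 : 0 < p := by positivity
  have hpq := Real.HolderConjugate.conjExponent hp
  set q := p.conjExponent
  have hq0 : 0 < q := hpq.symm.pos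
  have hpinv : 1 / p ≤ 1 := by rw [div_le_one hp0]; exact hp.le
  have hq : 1 / q = 1 - 1 / p := by
    have := hpq.inv_add_inv_eq_one
    simp only [one_div]; linarith
  have he : ∀ x : ℝ≥0∞, x ^ (1 + a - 1 / p) = x ^ a * x ^ (1 / q) := fun x => by
    rw [← ENNReal.rpow_add_of_nonneg _ _ ha (by positivity), hq]
    congr 1; ring
  have hsum : ∀ s : Finset ι, ∑ i ∈ s, V i ^ (1 + a - 1 / p) * A i ^ (1 / p)
      ≤ (∑' i, V i) ^ (1 + a - 1 / p) * (∑' i, A i) ^ (1 / p) := fun s => by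
    calc ∑ i ∈ s, V i ^ (1 + a - 1 / p) * A i ^ (1 / p)
        ≤ ∑ i ∈ s, (∑' i, V i) ^ a * (V i ^ (1 / q) * A i ^ (1 / p)) := by
          refine Finset.sum_le_sum fun i _ => ?_
          rw [he, mul_assoc]
          gcongr
          exact ENNReal.le_tsum i
      _ = (∑' i, V i) ^ a * ∑ i ∈ s, V i ^ (1 / q) * A i ^ (1 / p) := by rw [Finset.mul_sum]
      _ ≤ (∑' i, V i) ^ a * ((∑ i ∈ s, (V i ^ (1 / q)) ^ q) ^ (1 / q) *
            (∑ i ∈ s, (A i ^ (1 / p)) ^ p) ^ (1 / p)) := by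
          gcongr
          exact ENNReal.inner_le_Lp_mul_Lq _ _ _ hpq.symm
      _ = (∑' i, V i) ^ a * ((∑ i ∈ s, V i) ^ (1 / q) * (∑ i ∈ s, A i) ^ (1 / p)) := by
          simp only [← ENNReal.rpow_mul, one_div_mul_cancel hq0.ne', one_div_mul_cancel hp0.ne',
            ENNReal.rpow_one]
      _ ≤ (∑' i, V i) ^ a * ((∑' i, V i) ^ (1 / q) * (∑' i, A i) ^ (1 / p)) := by
          gcongr <;> exact ENNReal.sum_le_tsum s
      _ = _ := by rw [he, mul_assoc]
  exact ENNReal.summable.tsum_le_of_sum_le hsum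

section Poincare

variable {n : ℕ} {Q₀ : Cube n} {p : ℝ} {f g : (Fin n → ℝ) → ℝ} {c : ℝ}

lemma tsum_setLIntegral_le_of_mem_cubePackings {F : Set (Cube n)} (hF : F ∈ cubePackings Q₀)
    (h : (Fin n → ℝ) → ℝ≥0∞) :
    ∑' Q : F, ∫⁻ x in Q.1.toSet, h x ≤ ∫⁻ x in Q₀.toSet, h x := by
  have : Countable F := hF.1.to_subtype
  -- The closed cubes may share faces; these are null, and the interiors are disjoint.
  calc ∑' Q : F, ∫⁻ x in Q.1.toSet, h x
      = ∑' Q : F, ∫⁻ x in interior Q.1.toSet, h x := by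
        congr 1 with Q
        exact (setLIntegral_congr Q.1.interior_ae_eq).symm
    _ = ∫⁻ x in ⋃ Q : F, interior Q.1.toSet, h x := by
        refine (lintegral_iUnion (fun Q => isOpen_interior.measurableSet) ?_ _).symm
        intro Q R hQR
        exact hF.2.2 Q.2 R.2 fun h => hQR (Subtype.ext h)
    _ ≤ ∫⁻ x in Q₀.toSet, h x := by
        refine lintegral_mono_set (Set.iUnion_subset fun Q => ?_)
        exact interior_subset.trans (hF.2.1 _ Q.2)

namespace PoincareWith

lemma integrableOn_rpow (hf : PoincareWith Q₀ p f c g) (hp : 0 < p) :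
    IntegrableOn (fun x => |g x| ^ p) Q₀.toSet := by
  have h := hf.memLp.integrable_norm_rpow (by simpa using hp) ENNReal.ofReal_ne_top
  simpa [ENNReal.toReal_ofReal hp.le, IntegrableOn] using h

lemma ofReal_setAverage_rpow (hf : PoincareWith Q₀ p f c g) (hp : 0 < p) {Q : Cube n}
    (hQ : Q.toSet ⊆ Q₀.toSet) :
    ENNReal.ofReal (⨍ x in Q.toSet, |g x| ^ p) = (∫⁻ x in Q.toSet, ‖g x‖ₑ ^ p) / volume Q.toSet := by
  rw [ofReal_setAverage ((hf.integrableOn_rpow hp).mono_set hQ)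
    (Eventually.of_forall fun x => by positivity)]
  simp only [Real.enorm_eq_ofReal_abs, ENNReal.ofReal_rpow_of_nonneg (abs_nonneg _) hp.le]

lemma eLpNorm_eq (g : (Fin n → ℝ) → ℝ) (hp : 0 < p) (Q : Cube n) :
    eLpNorm g (ENNReal.ofReal p) (volume.restrict Q.toSet)
      = (∫⁻ x in Q.toSet, ‖g x‖ₑ ^ p) ^ (1 / p) := by
  rw [eLpNorm_eq_lintegral_rpow_enorm_toReal (by simpa using hp) ENNReal.ofReal_ne_top,
    ENNReal.toReal_ofReal hp.le]

lemma volume_mul_meanOsc_le (hf : PoincareWith Q₀ p f c g) (hp : 1 < p) (hn : 0 < n) {Q : Cube n}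
    (hQ : Q.toSet ⊆ Q₀.toSet) :
    volume Q.toSet * ENNReal.ofReal (Q.meanOsc f) ≤ ENNReal.ofReal c *
      (volume Q.toSet ^ (1 + 1 / (n : ℝ) - 1 / p) * (∫⁻ x in Q.toSet, ‖g x‖ₑ ^ p) ^ (1 / p)) := by
  have hp0 : 0 < p := by positivity
  have hn0 : (0 : ℝ) < n := by exact_mod_cast hn
  have ha : 0 ≤ ⨍ x in Q.toSet, |g x| ^ p := by
    rw [setAverage_eq]
    exact smul_nonneg (by positivity) (integral_nonneg fun x => by positivity)
  have hside : ENNReal.ofReal Q.side = volume Q.toSet ^ (1 / (n : ℝ)) := by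
    rw [Q.volume_toSet, ← ENNReal.rpow_natCast, ← ENNReal.rpow_mul, mul_one_div_cancel hn0.ne',
      ENNReal.rpow_one]
  calc volume Q.toSet * ENNReal.ofReal (Q.meanOsc f)
      ≤ volume Q.toSet *
          ENNReal.ofReal (c * Q.side * (⨍ x in Q.toSet, |g x| ^ p) ^ (1 / p)) := by
        gcongr; exact hf.bound Q hQ
    _ = _ := by
        rw [ENNReal.ofReal_mul (mul_nonneg hf.const_pos.le Q.side_pos.le),
          ENNReal.ofReal_mul hf.const_pos.le,
          ← ENNReal.ofReal_rpow_of_nonneg ha (by positivity), hf.ofReal_setAverage_rpow hp0 hQ,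
          hside, ENNReal.div_rpow_of_nonneg _ _ (by positivity), div_eq_mul_inv (_ ^ (1 / p)),
          ← ENNReal.rpow_neg,
          show 1 + 1 / (n : ℝ) - 1 / p = 1 + 1 / n + -(1 / p) by ring,
          ENNReal.rpow_add _ _ Q.volume_ne_zero Q.volume_ne_top,
          ENNReal.rpow_add _ _ Q.volume_ne_zero Q.volume_ne_top, ENNReal.rpow_one]
        ring

lemma tsum_doubleOsc_le (hf : PoincareWith Q₀ p f c g) (hp : 1 < p) (hn : 0 < n)
    {F : Set (Cube n)} (hF : F ∈ cubePackings Q₀) :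
    ∑' Q : F, Q.1.doubleOsc f ≤ ENNReal.ofReal (2 * c) *
      eLpNorm g (ENNReal.ofReal p) (volume.restrict Q₀.toSet) *
        (∑' Q : F, volume Q.1.toSet) ^ (1 + 1 / (n : ℝ) - 1 / p) := by
  have hp0 : 0 < p := by positivity
  have h2 : ENNReal.ofReal (2 * c) = 2 * ENNReal.ofReal c := by
    rw [ENNReal.ofReal_mul zero_le_two, ENNReal.ofReal_ofNat]
  calc ∑' Q : F, Q.1.doubleOsc f
      ≤ ∑' Q : F, ENNReal.ofReal (2 * c) * (volume Q.1.toSet ^ (1 + 1 / (n : ℝ) - 1 / p) *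
          (∫⁻ x in Q.1.toSet, ‖g x‖ₑ ^ p) ^ (1 / p)) := by
        refine ENNReal.tsum_le_tsum fun Q => ?_
        have hQ := hF.2.1 _ Q.2
        refine (Q.1.doubleOsc_le (hf.integrable.mono_set hQ)).trans ?_
        rw [h2, mul_assoc]
        exact mul_le_mul_right (hf.volume_mul_meanOsc_le hp hn hQ) 2
    _ ≤ ENNReal.ofReal (2 * c) * ((∑' Q : F, volume Q.1.toSet) ^ (1 + 1 / (n : ℝ) - 1 / p) *
          (∑' Q : F, ∫⁻ x in Q.1.toSet, ‖g x‖ₑ ^ p) ^ (1 / p)) := by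
        rw [ENNReal.tsum_mul_left]
        gcongr
        exact ENNReal.tsum_rpow_mul_rpow_le _ _ hp (by positivity)
    _ ≤ ENNReal.ofReal (2 * c) * ((∑' Q : F, volume Q.1.toSet) ^ (1 + 1 / (n : ℝ) - 1 / p) *
          eLpNorm g (ENNReal.ofReal p) (volume.restrict Q₀.toSet)) := by
        rw [eLpNorm_eq g hp0]
        gcongr
        exact tsum_setLIntegral_le_of_mem_cubePackings hF _
    _ = _ := by ring

/-- Stating the exponent through `(r⁻¹).toReal` covers both `r = p*` and, when `p = n`, `r = ∞`. -/
lemma gaRoBound (hf : PoincareWith Q₀ p f c g) (hp : 1 < p) (hn : 0 < n) {r : ℝ≥0∞}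
    (hr : (r⁻¹).toReal = 1 / p - 1 / n) :
    GaRoBound Q₀ r f (ENNReal.ofReal (2 * c) *
      eLpNorm g (ENNReal.ofReal p) (volume.restrict Q₀.toSet)) := fun F hF => by
  have h := hf.tsum_doubleOsc_le hp hn hF
  rwa [show 1 + 1 / (n : ℝ) - 1 / p = 1 - (r⁻¹).toReal by rw [hr]; ring] at h

end PoincareWith

lemma poincareClass_subset_GaRo_top (hn : 1 < n) (Q₀ : Cube n) :
    PoincareClass Q₀ n ⊆ GaRo Q₀ ∞ := by
  rintro f ⟨c, g, hf⟩
  have hB := hf.gaRoBound (r := ∞) (by exact_mod_cast hn) (by lia) (by simp)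
  set C := ENNReal.ofReal (2 * c) * eLpNorm g (ENNReal.ofReal n) (volume.restrict Q₀.toSet) with hC
  have hCtop : C ≠ ∞ := ENNReal.mul_ne_top ENNReal.ofReal_ne_top hf.memLp.eLpNorm_ne_top
  refine ⟨hf.integrable, C.toNNReal + 1, by positivity, fun F hF => (hB F hF).trans ?_⟩
  gcongr
  push_cast
  rw [ENNReal.coe_toNNReal hCtop]
  exact le_self_add

end Poincare

/-! ### Cubical maximal function and cubes shrinking to a point. -/

namespace Cube

variable {n : ℕ}

lemma side_le_of_subset (hn : 0 < n) {Q R : Cube n} (h : Q.toSet ⊆ R.toSet) :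
    Q.side ≤ R.side := by
  have hQ : Q.corner ≤ fun i => Q.corner i + Q.side := fun i => by
    simpa using Q.side_pos.le
  have h1 := (h ⟨le_rfl, hQ⟩).1 ⟨0, hn⟩
  have h2 := (h ⟨hQ, le_rfl⟩).2 ⟨0, hn⟩
  simp only at h1 h2
  linarith

/-- The set where the cubical maximal function of `h`, taken over subcubes of `Q₀`, exceeds `s`. -/
def maximalSet (Q₀ : Cube n) (h : (Fin n → ℝ) → ℝ≥0∞) (s : ℝ≥0∞) : Set (Fin n → ℝ) :=
  {x | ∃ Q : Cube n, x ∈ Q.toSet ∧ Q.toSet ⊆ Q₀.toSet ∧ s * volume Q.toSet < ∫⁻ y in Q.toSet, h y}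

/-- Weak (1,1) bound by Vitali covering: cubes are closed balls of the sup norm, and fivefold
enlargement costs `5^n`. Only outer measure is used, so `h` may be arbitrary. -/
lemma mul_volume_maximalSet_le (hn : 0 < n) (Q₀ : Cube n) (h : (Fin n → ℝ) → ℝ≥0∞) (s : ℝ≥0∞) :
    s * volume (Q₀.maximalSet h s) ≤ 5 ^ n * ∫⁻ y in Q₀.toSet, h y := by
  set t : Set (Cube n) :=
    {Q | Q.toSet ⊆ Q₀.toSet ∧ s * volume Q.toSet < ∫⁻ y in Q.toSet, h y}
  obtain ⟨u, hut, hdisj, hcov⟩ := Vitali.exists_disjoint_subfamily_covering_enlargement_closedBall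
    t center (fun Q => Q.side / 2) (Q₀.side / 2)
    (fun Q hQ => by have := side_le_of_subset hn hQ.1; linarith) 5 (by norm_num)
  have hdisj' : u.PairwiseDisjoint fun Q => Q.toSet := by
    simpa only [toSet_eq_closedBall] using hdisj
  have hu : u.Countable := hdisj'.countable_of_nonempty_interior fun Q _ => Q.interior_nonempty
  have hE : Q₀.maximalSet h s ⊆ ⋃ Q ∈ u, closedBall Q.center (5 * (Q.side / 2)) := by
    rintro x ⟨Q, hx, hQ, hlt⟩
    obtain ⟨R, hR, hQR⟩ := hcov Q ⟨hQ, hlt⟩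
    exact Set.mem_biUnion hR (hQR (Q.toSet_eq_closedBall ▸ hx))
  have : Countable u := hu.to_subtype
  calc s * volume (Q₀.maximalSet h s)
      ≤ s * ∑' Q : u, volume (closedBall Q.1.center (5 * (Q.1.side / 2))) := by
        gcongr
        exact (measure_mono hE).trans (measure_biUnion_le _ hu _)
    _ = 5 ^ n * ∑' Q : u, s * volume Q.1.toSet := by
        rw [← ENNReal.tsum_mul_left, ← ENNReal.tsum_mul_left]
        congr 1 with Q
        rw [volume_closedBall_center _ (by norm_num), ENNReal.ofReal_ofNat]
        ring
    _ ≤ 5 ^ n * ∑' Q : u, ∫⁻ y in Q.1.toSet, h y := by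
        gcongr with Q
        exact (hut Q.2).2.le
    _ = 5 ^ n * ∫⁻ y in ⋃ Q : u, Q.1.toSet, h y := by
        rw [lintegral_iUnion (fun Q : u => Q.1.measurableSet_toSet)]
        intro Q R hQR
        exact hdisj' Q.2 R.2 fun h => hQR (Subtype.ext h)
    _ ≤ _ := by
        gcongr
        exact Set.iUnion_subset fun Q => (hut Q.2).1

/-- The image of `Q` under the homothety with center `x` and ratio `t`. -/
def shrink (Q : Cube n) (x : Fin n → ℝ) (t : ℝ) (ht : 0 < t) : Cube n where
  corner i := x i - t * (x i - Q.corner i)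
  side := t * Q.side
  side_pos := mul_pos ht Q.side_pos

/-- Homotheties centered at `x`, unlike cubes centered at `x`, stay inside `Q` even when `x` is on
its boundary. -/
lemma mem_shrink {Q : Cube n} {x : Fin n → ℝ} (hx : x ∈ Q.toSet) {t : ℝ} (ht : 0 < t) :
    x ∈ (Q.shrink x t ht).toSet := by
  refine ⟨fun i => ?_, fun i => ?_⟩
  · have := hx.1 i
    simp only [shrink]; nlinarith
  · have := hx.2 i
    simp only [shrink] at this ⊢; nlinarith

lemma shrink_subset_shrink {Q : Cube n} {x : Fin n → ℝ} (hx : x ∈ Q.toSet) {t u : ℝ} (ht : 0 < t)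
    (htu : t ≤ u) :
    (Q.shrink x t ht).toSet ⊆ (Q.shrink x u (ht.trans_le htu)).toSet := by
  refine Set.Icc_subset_Icc (fun i => ?_) fun i => ?_
  · have := hx.1 i
    simp only [shrink]; nlinarith
  · have := hx.2 i
    simp only [shrink] at this ⊢; nlinarith

lemma shrink_one (Q : Cube n) (x : Fin n → ℝ) : Q.shrink x 1 one_pos = Q := by
  simp [shrink]

lemma shrink_subset {Q : Cube n} {x : Fin n → ℝ} (hx : x ∈ Q.toSet) {t : ℝ} (ht : 0 < t)
    (ht1 : t ≤ 1) : (Q.shrink x t ht).toSet ⊆ Q.toSet := by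
  simpa [shrink_one] using shrink_subset_shrink hx ht ht1

lemma abs_mean_sub_mean_le {Q R : Cube n} {f : (Fin n → ℝ) → ℝ} (hf : IntegrableOn f Q.toSet)
    (hRQ : R.toSet ⊆ Q.toSet) :
    |R.mean f - Q.mean f| ≤ (Q.side / R.side) ^ n * Q.meanOsc f := by
  have hV : 0 < R.side ^ n := pow_pos R.side_pos n
  have hW : 0 < Q.side ^ n := pow_pos Q.side_pos n
  have hc : IntegrableOn (fun _ => Q.mean f) R.toSet := integrableOn_const R.volume_ne_top
  have hcQ : IntegrableOn (fun _ => Q.mean f) Q.toSet := integrableOn_const Q.volume_ne_top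
  have h1 : R.mean f - Q.mean f = (R.side ^ n)⁻¹ * ∫ x in R.toSet, (f x - Q.mean f) := by
    rw [integral_sub (hf.mono_set hRQ) hc, setIntegral_const, mean, setAverage_eq, volume_real,
      smul_eq_mul, smul_eq_mul, mul_sub, inv_mul_cancel_left₀ hV.ne']
  have h2 : ∫ x in Q.toSet, |f x - Q.mean f| = Q.side ^ n * Q.meanOsc f := by
    rw [meanOsc, setAverage_eq, volume_real, smul_eq_mul, mul_inv_cancel_left₀ hW.ne']
  calc |R.mean f - Q.mean f|
      = (R.side ^ n)⁻¹ * |∫ x in R.toSet, (f x - Q.mean f)| := by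
        rw [h1, abs_mul, abs_of_pos (inv_pos.2 hV)]
    _ ≤ (R.side ^ n)⁻¹ * ∫ x in R.toSet, |f x - Q.mean f| := by
        gcongr; exact abs_integral_le_integral_abs
    _ ≤ (R.side ^ n)⁻¹ * ∫ x in Q.toSet, |f x - Q.mean f| := by
        refine mul_le_mul_of_nonneg_left ?_ (by positivity)
        exact setIntegral_mono_set (hf.sub hcQ).abs (Eventually.of_forall fun x => abs_nonneg _)
          hRQ.eventuallyLE
    _ = _ := by rw [h2, div_pow]; field_simp

/-- The sequence of cubes shrinking dyadically to a point of `Q`. -/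
def dyadicShrink (Q : Cube n) (x : Fin n → ℝ) (k : ℕ) : Cube n :=
  Q.shrink x ((1 / 2) ^ k) (by positivity)

lemma dyadicShrink_zero (Q : Cube n) (x : Fin n → ℝ) : Q.dyadicShrink x 0 = Q := by
  simp [dyadicShrink, shrink]

lemma dyadicShrink_side (Q : Cube n) (x : Fin n → ℝ) (k : ℕ) :
    (Q.dyadicShrink x k).side = (1 / 2) ^ k * Q.side := rfl

lemma mem_dyadicShrink {Q : Cube n} {x : Fin n → ℝ} (hx : x ∈ Q.toSet) (k : ℕ) :
    x ∈ (Q.dyadicShrink x k).toSet := mem_shrink hx _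

lemma dyadicShrink_subset {Q : Cube n} {x : Fin n → ℝ} (hx : x ∈ Q.toSet) (k : ℕ) :
    (Q.dyadicShrink x k).toSet ⊆ Q.toSet :=
  shrink_subset hx _ (pow_le_one₀ (by norm_num) (by norm_num))

lemma dyadicShrink_succ_subset {Q : Cube n} {x : Fin n → ℝ} (hx : x ∈ Q.toSet) (k : ℕ) :
    (Q.dyadicShrink x (k + 1)).toSet ⊆ (Q.dyadicShrink x k).toSet :=
  shrink_subset_shrink hx _ (pow_le_pow_of_le_one (by norm_num) (by norm_num) k.le_succ)

lemma abs_mean_dyadicShrink_sub_le {Q : Cube n} {f : (Fin n → ℝ) → ℝ}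
    (hf : IntegrableOn f Q.toSet) {x : Fin n → ℝ} (hx : x ∈ Q.toSet) (N : ℕ) :
    |(Q.dyadicShrink x N).mean f - Q.mean f|
      ≤ 2 ^ n * ∑ k ∈ Finset.range N, (Q.dyadicShrink x k).meanOsc f := by
  induction N with
  | zero => simp [dyadicShrink_zero]
  | succ N ih =>
    have h := abs_mean_sub_mean_le (hf.mono_set (dyadicShrink_subset hx N))
      (dyadicShrink_succ_subset hx N)
    have hr : (Q.dyadicShrink x N).side / (Q.dyadicShrink x (N + 1)).side = 2 := by
      have := Q.side_pos
      rw [dyadicShrink_side, dyadicShrink_side, pow_succ]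
      field_simp
    rw [hr] at h
    rw [Finset.sum_range_succ, mul_add]
    have := abs_sub_le ((Q.dyadicShrink x (N + 1)).mean f) ((Q.dyadicShrink x N).mean f) (Q.mean f)
    linarith

lemma ae_tendsto_mean_dyadicShrink (Q : Cube n) {f : (Fin n → ℝ) → ℝ}
    (hf : IntegrableOn f Q.toSet) :
    ∀ᵐ x ∂volume.restrict Q.toSet,
      Tendsto (fun k => (Q.dyadicShrink x k).mean f) atTop (𝓝 (f x)) := by
  have hloc : LocallyIntegrable (Q.toSet.indicator f) :=
    (hf.integrable_indicator Q.measurableSet_toSet).locallyIntegrable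
  rw [ae_restrict_iff' Q.measurableSet_toSet]
  -- This form of Lebesgue differentiation allows balls that contain `x` without being centered
  -- there.
  filter_upwards [IsUnifLocDoublingMeasure.ae_tendsto_average volume hloc 1] with x hx hxQ
  have hlim : Tendsto (fun k => (Q.dyadicShrink x k).side / 2) atTop (𝓝[>] 0) := by
    refine tendsto_nhdsWithin_iff.2 ⟨?_, Eventually.of_forall fun k =>
      half_pos (Q.dyadicShrink x k).side_pos⟩
    have : Tendsto (fun k : ℕ => (1 / 2 : ℝ) ^ k * Q.side / 2) atTop (𝓝 (0 * Q.side / 2)) :=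
      ((tendsto_pow_atTop_nhds_zero_of_lt_one (by norm_num) (by norm_num)).mul_const _).div_const _
    simpa [dyadicShrink_side] using this
  have h := hx (fun k => (Q.dyadicShrink x k).center) _ hlim (Eventually.of_forall fun k => by
    rw [one_mul, ← toSet_eq_closedBall]; exact mem_dyadicShrink hxQ k)
  rw [Set.indicator_of_mem hxQ] at h
  refine h.congr fun k => ?_
  rw [← toSet_eq_closedBall]
  exact setAverage_congr_fun (measurableSet_toSet _) (Eventually.of_forall fun y hy =>
    Set.indicator_of_mem (dyadicShrink_subset hxQ k hy) f)

end Cube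

/-! ### Two-sided geometric sums, uniform in the starting scale. -/

lemma sum_min_geometric_le {ρ : ℝ} (h0 : 0 < ρ) (h1 : ρ < 1) (N : ℕ) {v : ℝ} (hv : 0 < v) :
    ∑ k ∈ Finset.range N, min (v * ρ ^ k) (v * ρ ^ k)⁻¹ ≤ 2 / (1 - ρ) := by
  have hρ : 0 < 1 - ρ := by linarith
  have small : ∀ (N : ℕ) {v : ℝ}, 0 < v →
      ∑ k ∈ Finset.range N, min (v * ρ ^ k) (v * ρ ^ k)⁻¹ ≤ v / (1 - ρ) := by
    intro N v hv
    calc ∑ k ∈ Finset.range N, min (v * ρ ^ k) (v * ρ ^ k)⁻¹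
        ≤ ∑ k ∈ Finset.range N, v * ρ ^ k := Finset.sum_le_sum fun k _ => min_le_left _ _
      _ = v * ∑ k ∈ Finset.range N, ρ ^ k := by rw [Finset.mul_sum]
      _ ≤ v * (1 - ρ)⁻¹ := by
          gcongr
          rw [← tsum_geometric_of_lt_one h0.le h1]
          exact (summable_geometric_of_lt_one h0.le h1).sum_le_tsum _ fun k _ => by positivity
      _ = _ := by rw [div_eq_mul_inv]
  -- The correction `- ρ * v⁻¹` closes the induction: the first term is at most `v⁻¹`, the others
  -- form the sum starting at `v * ρ`, and `(2 - v⁻¹)/(1 - ρ) + v⁻¹ = (2 - ρ v⁻¹)/(1 - ρ)`.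
  have large : ∀ (N : ℕ) {v : ℝ}, 1 ≤ v →
      ∑ k ∈ Finset.range N, min (v * ρ ^ k) (v * ρ ^ k)⁻¹ ≤ (2 - ρ * v⁻¹) / (1 - ρ) := by
    intro N
    induction N with
    | zero =>
      intro v hv
      have : v⁻¹ ≤ 1 := inv_le_one_of_one_le₀ hv
      simp only [Finset.range_zero, Finset.sum_empty]
      refine div_nonneg ?_ hρ.le
      nlinarith
    | succ N ih =>
      intro v hv
      have hv0 : 0 < v := by linarith
      have hvi : v⁻¹ ≤ 1 := inv_le_one_of_one_le₀ hv
      have hstep : ∑ k ∈ Finset.range N, min (v * ρ ^ (k + 1)) (v * ρ ^ (k + 1))⁻¹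
          ≤ (2 - v⁻¹) / (1 - ρ) := by
        have he : ∀ k, v * ρ ^ (k + 1) = v * ρ * ρ ^ k := fun k => by ring
        simp only [he]
        rcases le_total (v * ρ) 1 with h | h
        · refine (small N (by positivity)).trans ?_
          gcongr
          linarith
        · refine (ih h).trans (le_of_eq ?_)
          rw [mul_inv, mul_comm v⁻¹, mul_inv_cancel_left₀ h0.ne']
      rw [Finset.sum_range_succ']
      have h2 : min (v * ρ ^ 0) (v * ρ ^ 0)⁻¹ ≤ v⁻¹ := by simp
      calc _ ≤ (2 - v⁻¹) / (1 - ρ) + v⁻¹ := add_le_add hstep h2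
        _ = _ := by field_simp; ring
  rcases le_total v 1 with h | h
  · refine (small N hv).trans ?_
    gcongr
    linarith
  · refine (large N h).trans ?_
    gcongr
    have : 0 < ρ * v⁻¹ := by positivity
    linarith

lemma exists_sum_min_rpow_le {α : ℝ} (hα : 0 < α) :
    ∃ C : ℝ, 0 < C ∧ ∀ (N : ℕ) (u : ℝ), 0 < u →
      ∑ k ∈ Finset.range N, min ((1 / 2) ^ k * u) (((1 / 2) ^ k * u) ^ (-α)) ≤ C := by
  -- The smaller exponent serves on both sides of `w = 1`, reducing to the symmetric pair `w^β`,
  -- `w^(-β)`.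
  set β := min 1 α
  have hβ : 0 < β := lt_min one_pos hα
  set ρ : ℝ := (1 / 2) ^ β
  have h0 : 0 < ρ := by positivity
  have h1 : ρ < 1 := Real.rpow_lt_one (by norm_num) (by norm_num) hβ
  refine ⟨2 / (1 - ρ), div_pos two_pos (by linarith), fun N u hu => ?_⟩
  refine le_trans (Finset.sum_le_sum fun k _ => ?_)
    (sum_min_geometric_le h0 h1 N (Real.rpow_pos_of_pos hu β))
  have he : u ^ β * ρ ^ k = ((1 / 2) ^ k * u) ^ β := by
    rw [Real.mul_rpow (by positivity) hu.le, mul_comm, ← Real.rpow_natCast, ← Real.rpow_natCast,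
      ← Real.rpow_mul (by norm_num), ← Real.rpow_mul (by norm_num), mul_comm β]
  rw [he]
  set w : ℝ := (1 / 2) ^ k * u
  have hw : 0 < w := by positivity
  rw [← Real.rpow_neg hw.le]
  rcases le_total w 1 with h | h
  · refine (min_le_left _ _).trans (le_min ?_ ?_)
    · simpa using Real.rpow_le_rpow_of_exponent_ge hw h (min_le_left 1 α)
    · simpa using Real.rpow_le_rpow_of_exponent_ge hw h (show -β ≤ 1 by linarith)
  · refine (min_le_right _ _).trans (le_min ?_ ?_)
    · exact Real.rpow_le_rpow_of_exponent_le h (by linarith)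
    · exact Real.rpow_le_rpow_of_exponent_le h (neg_le_neg (min_le_right 1 α))

/-! ### The weak-type estimate for `f - f_{Q₀}`. -/

section Poincare

variable {n : ℕ} {p q : ℝ}

namespace PoincareWith

variable {Q₀ : Cube n} {f g : (Fin n → ℝ) → ℝ} {c : ℝ}

/-- `B^(p/n) s^(-1/n)` is the side at which the local bound (averages at most `s`) and the global
bound (`∫|g|^p ≤ B^p`) coincide; in units of it they become `u` and `u^(-(n/p - 1))`. -/
lemma meanOsc_le (hf : PoincareWith Q₀ p f c g) (hp : 0 < p) (hn : 0 < n)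
    (hq : 1 / q = 1 / p - 1 / n) {B s : ℝ} (hB : 0 < B) (hs : 0 < s) {Q : Cube n}
    (hQ : Q.toSet ⊆ Q₀.toSet) (hg : ∫ x in Q₀.toSet, |g x| ^ p ≤ B ^ p)
    (hav : ⨍ x in Q.toSet, |g x| ^ p ≤ s) :
    Q.meanOsc f ≤ c * (B ^ (p / n) * s ^ (1 / q)) *
      min (Q.side * (B ^ (p / n) * s ^ (-(1 / n : ℝ)))⁻¹)
        ((Q.side * (B ^ (p / n) * s ^ (-(1 / n : ℝ)))⁻¹) ^ (-(n / p - 1))) := by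
  have hn0 : (0 : ℝ) < n := by exact_mod_cast hn
  have hc := hf.const_pos
  have hl := Q.side_pos
  have ha : 0 ≤ ⨍ x in Q.toSet, |g x| ^ p := by
    rw [setAverage_eq]
    exact smul_nonneg (by positivity) (integral_nonneg fun x => by positivity)
  have hav2 : ⨍ x in Q.toSet, |g x| ^ p ≤ B ^ p / Q.side ^ n := by
    rw [setAverage_eq, Q.volume_real, smul_eq_mul, inv_mul_eq_div]
    gcongr
    exact (setIntegral_mono_set (hf.integrableOn_rpow hp)
      (Eventually.of_forall fun x => by positivity) hQ.eventuallyLE).trans hg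
  have hb := hf.bound Q hQ
  have hss : s ^ (1 / q) = s ^ (1 / p) * s ^ (-(1 / n : ℝ)) := by
    rw [hq, sub_eq_add_neg, Real.rpow_add hs]
  rw [mul_min_of_nonneg _ _ (by positivity)]
  refine le_min (hb.trans ?_) (hb.trans ?_)
  · calc c * Q.side * (⨍ x in Q.toSet, |g x| ^ p) ^ (1 / p) ≤ c * Q.side * s ^ (1 / p) := by
          gcongr
      _ = _ := by rw [hss]; field_simp
  · have h1 : (B ^ p / Q.side ^ n) ^ (1 / p) = B * Q.side ^ (-(n / p)) := by
      rw [Real.div_rpow (by positivity) (by positivity), ← Real.rpow_mul hB.le,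
        mul_one_div_cancel hp.ne', Real.rpow_one, ← Real.rpow_natCast, ← Real.rpow_mul hl.le,
        Real.rpow_neg hl.le, div_eq_mul_inv, mul_one_div]
    have h2 : (B ^ (p / n) * s ^ (-(1 / n : ℝ)))⁻¹ ^ (-(n / p - 1))
        = B * (B ^ (p / n))⁻¹ * (s ^ (1 / q))⁻¹ := by
      rw [Real.inv_rpow (by positivity), ← Real.rpow_neg (by positivity), neg_neg,
        Real.mul_rpow (by positivity) (by positivity), ← Real.rpow_mul hB.le,
        ← Real.rpow_mul hs.le, ← Real.rpow_neg hB.le, ← Real.rpow_neg hs.le, hq]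
      nth_rewrite 2 [← Real.rpow_one B]
      rw [← Real.rpow_add hB]
      congr 2 <;> field_simp
      ring
    calc c * Q.side * (⨍ x in Q.toSet, |g x| ^ p) ^ (1 / p)
        ≤ c * Q.side * (B ^ p / Q.side ^ n) ^ (1 / p) := by gcongr
      _ = c * B * (Q.side ^ (1 : ℝ) * Q.side ^ (-(n / p))) := by rw [h1, Real.rpow_one]; ring
      _ = c * B * Q.side ^ (-(n / p - 1)) := by
          rw [← Real.rpow_add hl]; congr 2; ring
      _ = _ := by
          rw [Real.mul_rpow hl.le (by positivity), h2]
          field_simp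

lemma abs_sub_mean_le (hf : PoincareWith Q₀ p f c g) (hp : 0 < p) (hn : 0 < n)
    (hq : 1 / q = 1 / p - 1 / n) {B s C : ℝ} (hB : 0 < B) (hs : 0 < s)
    (hC : ∀ (N : ℕ) (u : ℝ), 0 < u → ∑ k ∈ Finset.range N,
      min ((1 / 2) ^ k * u) (((1 / 2) ^ k * u) ^ (-(n / p - 1))) ≤ C)
    (hg : ∫ x in Q₀.toSet, |g x| ^ p ≤ B ^ p) {x : Fin n → ℝ} (hx : x ∈ Q₀.toSet)
    (hlim : Tendsto (fun k => (Q₀.dyadicShrink x k).mean f) atTop (𝓝 (f x)))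
    (hav : ∀ Q : Cube n, x ∈ Q.toSet → Q.toSet ⊆ Q₀.toSet → ⨍ y in Q.toSet, |g y| ^ p ≤ s) :
    |f x - Q₀.mean f| ≤ 2 ^ n * (c * (B ^ (p / n) * s ^ (1 / q)) * C) := by
  have hc := hf.const_pos
  refine le_of_tendsto (hlim.sub_const _).abs (Eventually.of_forall fun N => ?_)
  refine (Cube.abs_mean_dyadicShrink_sub_le hf.integrable hx N).trans ?_
  gcongr
  calc ∑ k ∈ Finset.range N, (Q₀.dyadicShrink x k).meanOsc f
      ≤ ∑ k ∈ Finset.range N, c * (B ^ (p / n) * s ^ (1 / q)) *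
          min ((1 / 2) ^ k * (Q₀.side * (B ^ (p / n) * s ^ (-(1 / n : ℝ)))⁻¹))
            (((1 / 2) ^ k * (Q₀.side * (B ^ (p / n) * s ^ (-(1 / n : ℝ)))⁻¹))
              ^ (-(n / p - 1))) := by
        refine Finset.sum_le_sum fun k _ => ?_
        have h := hf.meanOsc_le hp hn hq hB hs (Cube.dyadicShrink_subset hx k) hg
          (hav _ (Cube.mem_dyadicShrink hx k) (Cube.dyadicShrink_subset hx k))
        rwa [Cube.dyadicShrink_side, mul_assoc ((1 / 2 : ℝ) ^ k)] at h
    _ ≤ _ := by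
        rw [← Finset.mul_sum]
        have := Q₀.side_pos
        gcongr
        exact hC N _ (by positivity)

lemma rpow_mul_rearrangement_le (hf : PoincareWith Q₀ p f c g) (hp : 0 < p) (hn : 0 < n)
    (hq0 : 0 < q) (hq : 1 / q = 1 / p - 1 / n) {B C : ℝ} (hB : 0 < B)
    (hC : ∀ (N : ℕ) (u : ℝ), 0 < u → ∑ k ∈ Finset.range N,
      min ((1 / 2) ^ k * u) (((1 / 2) ^ k * u) ^ (-(n / p - 1))) ≤ C)
    (hg : eLpNorm g (ENNReal.ofReal p) (volume.restrict Q₀.toSet) ≤ ENNReal.ofReal B)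
    {t : ℝ≥0} (ht : 0 < t) :
    (t : ℝ≥0∞) ^ (1 / q) *
        rearrangement (volume.restrict Q₀.toSet) (fun x => f x - Q₀.mean f) t
      ≤ ENNReal.ofReal (2 ^ n * C * (5 ^ n : ℝ) ^ (1 / q) * c) * ENNReal.ofReal B := by
  have hn0 : (0 : ℝ) < n := by exact_mod_cast hn
  have htr : (0 : ℝ) < t := by exact_mod_cast ht
  have htE : (t : ℝ≥0∞) = ENNReal.ofReal t := by simp
  have hc := hf.const_pos
  have hC0 : 0 ≤ C := by simpa using hC 0 1 one_pos
  have hgE : ∫⁻ x in Q₀.toSet, ‖g x‖ₑ ^ p ≤ ENNReal.ofReal (B ^ p) := by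
    rw [eLpNorm_eq g hp, one_div, ENNReal.rpow_inv_le_iff hp,
      ENNReal.ofReal_rpow_of_nonneg hB.le hp.le] at hg
    exact hg
  have hgR : ∫ x in Q₀.toSet, |g x| ^ p ≤ B ^ p := by
    rw [← ENNReal.ofReal_le_ofReal_iff (by positivity),
      ofReal_integral_eq_lintegral_ofReal (hf.integrableOn_rpow hp)
        (Eventually.of_forall fun x => by positivity)]
    simpa only [Real.enorm_eq_ofReal_abs, ENNReal.ofReal_rpow_of_nonneg (abs_nonneg _) hp.le]
      using hgE
  -- Chosen so that the maximal inequality gives `volume E ≤ t`.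
  set s : ℝ := 5 ^ n * (B ^ p / t) with hs_def
  have hs : 0 < s := by positivity
  set E := Q₀.maximalSet (fun x => ‖g x‖ₑ ^ p) (ENNReal.ofReal s)
  have hE : volume E ≤ t := by
    have h := (Q₀.mul_volume_maximalSet_le hn (fun x => ‖g x‖ₑ ^ p) (ENNReal.ofReal s)).trans
      (mul_le_mul_right hgE _)
    have h5 : (5 : ℝ≥0∞) ^ n * ENNReal.ofReal (B ^ p) = ENNReal.ofReal s * t := by
      rw [htE, ← ENNReal.ofReal_mul hs.le, show s * t = 5 ^ n * B ^ p by rw [hs_def]; field_simp,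
        ENNReal.ofReal_mul (by positivity), ENNReal.ofReal_pow (by norm_num),
        ENNReal.ofReal_ofNat]
    rw [h5] at h
    exact (ENNReal.mul_le_mul_iff_right (by simpa using hs) ENNReal.ofReal_ne_top).1 h
  set M : ℝ := 2 ^ n * (c * (B ^ (p / n) * s ^ (1 / q)) * C)
  have hM : rearrangement (volume.restrict Q₀.toSet) (fun x => f x - Q₀.mean f) t
      ≤ ENNReal.ofReal M := by
    refine sInf_le ?_
    refine le_trans (measure_mono_ae ?_) ((Measure.restrict_apply_le _ E).trans hE)
    filter_upwards [Q₀.ae_tendsto_mean_dyadicShrink hf.integrable,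
      ae_restrict_mem Q₀.measurableSet_toSet] with x hlim hx hlt
    by_contra hxE
    refine (not_lt.2 ?_) hlt
    show ‖f x - Q₀.mean f‖ₑ ≤ _
    rw [Real.enorm_eq_ofReal_abs]
    refine ENNReal.ofReal_le_ofReal (hf.abs_sub_mean_le hp hn hq hB hs hC hgR hx hlim ?_)
    intro Q hxQ hQ
    rw [← ENNReal.ofReal_le_ofReal_iff hs.le, hf.ofReal_setAverage_rpow hp hQ]
    refine ENNReal.div_le_of_le_mul (not_lt.1 fun h => hxE ⟨Q, hxQ, hQ, h⟩)
  have hpow : (t : ℝ) ^ (1 / q) * M = 2 ^ n * C * (5 ^ n : ℝ) ^ (1 / q) * c * B := by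
    -- The powers of `B` recombine because `p/n + p/q = 1`.
    have hBB : B ^ (p / n) * (B ^ p) ^ (1 / q) = B := by
      rw [← Real.rpow_mul hB.le, ← Real.rpow_add hB, hq]
      conv_rhs => rw [← Real.rpow_one B]
      congr 1
      field_simp
      ring
    have hss : s ^ (1 / q) = (5 ^ n : ℝ) ^ (1 / q) * ((B ^ p) ^ (1 / q) / (t : ℝ) ^ (1 / q)) := by
      rw [hs_def, Real.mul_rpow (by positivity) (by positivity),
        Real.div_rpow (by positivity) htr.le]
    have ht0 : (t : ℝ) ^ (1 / q) ≠ 0 := (Real.rpow_pos_of_pos htr _).ne'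
    calc (t : ℝ) ^ (1 / q) * M
        = 2 ^ n * C * (5 ^ n : ℝ) ^ (1 / q) * c * (B ^ (p / n) * (B ^ p) ^ (1 / q)) *
            ((t : ℝ) ^ (1 / q) / (t : ℝ) ^ (1 / q)) := by
          simp only [M]; rw [hss]; ring
      _ = _ := by rw [hBB, div_self ht0, mul_one]
  calc _ ≤ (t : ℝ≥0∞) ^ (1 / q) * ENNReal.ofReal M := by gcongr
    _ = ENNReal.ofReal ((t : ℝ) ^ (1 / q) * M) := by
        rw [ENNReal.ofReal_mul (q := M) (by positivity), htE,
          ENNReal.ofReal_rpow_of_nonneg htr.le (by positivity)]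
    _ = _ := by rw [hpow, ENNReal.ofReal_mul (by positivity)]

end PoincareWith

lemma exists_weakNorm_sub_mean_le (hp : 0 < p) (hpn : p < n) (hq : 1 / q = 1 / p - 1 / n) :
    ∃ K : ℝ, 0 < K ∧
      ∀ (Q₀ : Cube n) (f g : (Fin n → ℝ) → ℝ) (c : ℝ), PoincareWith Q₀ p f c g →
        weakNorm Q₀ q (fun x => f x - Q₀.mean f) ≤
          ENNReal.ofReal (K * c) * eLpNorm g (ENNReal.ofReal p) (volume.restrict Q₀.toSet) := by
  have hn0 : (0 : ℝ) < n := hp.trans hpn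
  have hn : 0 < n := by exact_mod_cast hn0
  have hq0 : 0 < q := by
    rw [← one_div_pos, hq, sub_pos]
    exact one_div_lt_one_div_of_lt hp hpn
  obtain ⟨C, hC0, hC⟩ := exists_sum_min_rpow_le (α := n / p - 1)
    (by rw [sub_pos, lt_div_iff₀ hp]; linarith)
  refine ⟨2 ^ n * C * (5 ^ n : ℝ) ^ (1 / q), by positivity, fun Q₀ f g c hf => ?_⟩
  refine iSup₂_le fun t ht => ?_
  set G := eLpNorm g (ENNReal.ofReal p) (volume.restrict Q₀.toSet) with hG
  have hGtop : G ≠ ∞ := hf.memLp.eLpNorm_ne_top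
  -- The estimate needs `B > 0`, while `G` may vanish: take `B = G + ε` and let `ε → 0`.
  have hlim : Tendsto (fun ε : ℝ => ENNReal.ofReal (2 ^ n * C * (5 ^ n : ℝ) ^ (1 / q) * c) *
      ENNReal.ofReal (G.toReal + ε)) (𝓝[>] 0)
      (𝓝 (ENNReal.ofReal (2 ^ n * C * (5 ^ n : ℝ) ^ (1 / q) * c) *
        ENNReal.ofReal (G.toReal + 0))) := by
    refine Tendsto.mono_left ?_ nhdsWithin_le_nhds
    refine ENNReal.Tendsto.const_mul ?_ (Or.inr ENNReal.ofReal_ne_top)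
    exact ENNReal.tendsto_ofReal (tendsto_const_nhds.add tendsto_id)
  rw [add_zero, ENNReal.ofReal_toReal hGtop] at hlim
  refine ge_of_tendsto hlim ?_
  filter_upwards [self_mem_nhdsWithin] with ε hε
  refine hf.rpow_mul_rearrangement_le hp hn hq0 hq
    (add_pos_of_nonneg_of_pos ENNReal.toReal_nonneg hε) hC ?_ ht
  rw [← hG, ← ENNReal.ofReal_toReal hGtop]
  refine ENNReal.ofReal_le_ofReal ?_
  rw [ENNReal.toReal_ofReal ENNReal.toReal_nonneg]
  exact le_add_of_nonneg_right (le_of_lt hε)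

end Poincare

/-! ### From `f - f_{Q₀}` back to `f`. -/

lemma rearrangement_le_rearrangement_sub_const_add {α : Type*} [MeasurableSpace α]
    (μ : Measure α) (f : α → ℝ) (m : ℝ) (t : ℝ≥0) :
    rearrangement μ f t ≤ rearrangement μ (fun x => f x - m) t + ‖m‖ₑ := by
  rw [← tsub_le_iff_right]
  refine le_sInf fun s hs => ?_
  rw [tsub_le_iff_right]
  refine sInf_le ((measure_mono fun x hx => ?_).trans hs)
  have h : s + ‖m‖ₑ < ‖f x - m‖ₑ + ‖m‖ₑ := by
    refine lt_of_lt_of_le hx ?_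
    simpa using enorm_add_le (f x - m) m
  exact lt_of_add_lt_add_right h

/-- Constants have finite weak norm because the rearrangement vanishes for `t ≥ |Q₀|`, leaving
`t^(1/q) ≤ |Q₀|^(1/q)`. -/
lemma weakNorm_le_weakNorm_sub_const_add {n : ℕ} (Q₀ : Cube n) {q : ℝ} (hq : 0 < q)
    (f : (Fin n → ℝ) → ℝ) (m : ℝ) :
    weakNorm Q₀ q f
      ≤ weakNorm Q₀ q (fun x => f x - m) + volume Q₀.toSet ^ (1 / q) * ‖m‖ₑ := by
  refine iSup₂_le fun t ht => ?_
  rcases le_total (volume Q₀.toSet) t with h | h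
  · have h0 : rearrangement (volume.restrict Q₀.toSet) f t = 0 := by
      refine le_antisymm (sInf_le ?_) bot_le
      refine (measure_mono (Set.subset_univ _)).trans ?_
      rwa [Measure.restrict_apply_univ]
    simp [h0]
  · calc (t : ℝ≥0∞) ^ (1 / q) * rearrangement (volume.restrict Q₀.toSet) f t
        ≤ (t : ℝ≥0∞) ^ (1 / q) *
            rearrangement (volume.restrict Q₀.toSet) (fun x => f x - m) t
          + (t : ℝ≥0∞) ^ (1 / q) * ‖m‖ₑ := by
          rw [← mul_add]
          gcongr
          exact rearrangement_le_rearrangement_sub_const_add _ f m t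
      _ ≤ _ := by
          gcongr
          exact le_iSup₂ (f := fun (t : ℝ≥0) (_ : 0 < t) => (t : ℝ≥0∞) ^ (1 / q) *
            rearrangement (volume.restrict Q₀.toSet) (fun x => f x - m) t) t ht

lemma poincareClass_subset_WeakL {n : ℕ} {p q : ℝ} (hp : 0 < p) (hpn : p < n)
    (hq : 1 / q = 1 / p - 1 / n) (Q₀ : Cube n) : PoincareClass Q₀ p ⊆ WeakL Q₀ q := by
  rintro f ⟨c, g, hf⟩
  have hq0 : 0 < q := by
    rw [← one_div_pos, hq, sub_pos]
    exact one_div_lt_one_div_of_lt hp hpn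
  obtain ⟨K, -, hK⟩ := exists_weakNorm_sub_mean_le hp hpn hq
  refine ⟨hf.integrable.aestronglyMeasurable, ?_⟩
  refine (weakNorm_le_weakNorm_sub_const_add Q₀ hq0 f (Q₀.mean f)).trans_lt ?_
  refine ENNReal.add_lt_top.2 ⟨(hK Q₀ f g c hf).trans_lt ?_, ?_⟩
  · exact ENNReal.mul_lt_top ENNReal.ofReal_lt_top hf.memLp.eLpNorm_lt_top
  · exact ENNReal.mul_lt_top
      (ENNReal.rpow_lt_top_of_nonneg (by positivity) Q₀.volume_ne_top) enorm_lt_top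

end

/-- The constant `cn` depends only on the dimension `n`, and `K` only on `n` and `p`; the exponent
`q` is `p*`. -/
theorem mainTheorem1 (n : ℕ) :
    ∃ cn : ℝ, 0 < cn ∧
      (∀ p q : ℝ, 1 < p → p < n → 1 / q = 1 / p - 1 / n →
        (∀ Q₀ : Cube n, PoincareClass Q₀ p ⊆ WeakL Q₀ q) ∧
        (∀ (Q₀ : Cube n) (f g : (Fin n → ℝ) → ℝ) (c : ℝ), PoincareWith Q₀ p f c g →
          gaRoNorm Q₀ (ENNReal.ofReal q) f ≤
            ENNReal.ofReal (2 * c * cn) *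
              eLpNorm g (ENNReal.ofReal p) (volume.restrict Q₀.toSet)) ∧
        (∃ K : ℝ, 0 < K ∧
          ∀ (Q₀ : Cube n) (f g : (Fin n → ℝ) → ℝ) (c : ℝ), PoincareWith Q₀ p f c g →
            weakNorm Q₀ q (fun x => f x - Q₀.mean f) ≤
              ENNReal.ofReal (K * c) *
                eLpNorm g (ENNReal.ofReal p) (volume.restrict Q₀.toSet))) ∧
      (1 < n → ∀ Q₀ : Cube n,
        PoincareClass Q₀ n ⊆ GaRo Q₀ ∞ ∧ GaRo Q₀ ∞ = BMO Q₀) := by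
  refine ⟨1, one_pos, fun p q hp hpn hq => ?_, fun hn Q₀ =>
    ⟨poincareClass_subset_GaRo_top hn Q₀, GaRo_top_eq_BMO Q₀⟩⟩
  have hp0 : 0 < p := one_pos.trans hp
  have hn : 0 < n := by exact_mod_cast hp0.trans hpn
  refine ⟨poincareClass_subset_WeakL hp0 hpn hq, fun Q₀ f g c hf => ?_,
    exists_weakNorm_sub_mean_le hp0 hpn hq⟩
  have hq0 : 0 < q := by
    rw [← one_div_pos, hq, sub_pos]
    exact one_div_lt_one_div_of_lt hp0 hpn
  rw [mul_one]
  refine sInf_le (hf.gaRoBound hp hn ?_)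
  rw [ENNReal.toReal_inv, ENNReal.toReal_ofReal hq0.le, ← one_div, hq]
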